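/- **Conventions.** Let $\mathbb{R}_+=(0,\infty)$ and, for $n\ge 1$, $$W_n=\{\lambda\in[0,\infty)^n:\lambda_1+\dots+\lambda_n>0\},\qquad W_n^0=\{\lambda\in[0,\infty)^n:\lambda_1>0\}.$$ For an interval $I\subseteq\mathbb{R}$, an *$\mathbb{R}$-weighted mean on $I$* is a function $\mathscr{M}:\bigcup_{n\ge1}I^n\times W_n\to I$ such that, for all $n\ge 1$, $x\in I^n$ and $\lambda,\mu\in W_n$: 1. $\mathscr{M}(x,t\lambda)=\mathscr{M}(x,\lambda)$ for all $t>0$; 2. $\mathscr{M}(x,\lambda+\mu)=\mathscr{M}\big((x_1,x_1,\dots,x_n,x_n),(\lambda_1,\mu_1,\dots,\lambda_n,\mu_n)\big)$; 3. $\min_i x_i\le\mathscr{M}(x,\lambda)\le\max_i x_i$; 4. if $\lambda_j=0$, then $\mathscr{M}(x,\lambda)$ does not change when the $j$-th coordinates of $x$ and $\lambda$ are deleted. It is *symmetric* if $\mathscr{M}(x\circ\sigma,\lambda\circ\sigma)=\mathscr{M}(x,\lambda)$ for all permutations $\sigma$, *Jensen concave* if $\mathscr{M}(\frac{x+y}2,\lambda)\ge\frac12\big(\mathscr{M}(x,\lambda)+\mathscr{M}(y,\lambda)\big)$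 for all $x,y\in I^n$ and $\lambda\in W_n$, and *continuous in the weights* if $\lambda\mapsto\mathscr{M}(x,\lambda)$ is continuous on $W_n$ for all $n$ and $x\in I^n$. Let $\mathscr{A}(x,\lambda)=\frac{\lambda_1x_1+\dots+\lambda_nx_n}{\lambda_1+\dots+\lambda_n}$. For $\lambda\in W_n^0$, the mean $\mathscr{M}$ satisfies the *$(n,\lambda)$-weighted Kedlaya inequality* if, for all $x\in I^n$, $$\mathscr{A}\Big(\big(\mathscr{M}((x_1,\dots,x_k),(\lambda_1,\dots,\lambda_k))\big)_{k=1}^n,\lambda\Big)\le\mathscr{M}\Big(\big(\mathscr{A}((x_1,\dots,x_k),(\lambda_1,\dots,\lambda_k))\big)_{k=1}^n,\lambda\Big).$$ For an interval $J$, let $W^{\mathbb{R}}_n(J)$ be the set of all $\lambda\in W_n^0$ such that every symmetric and Jensen concave $\mathbb{R}$-weighted mean on $J$ that is continuous in the weights satisfies the $(n,\lambda)$-weighted Kedlaya inequality. For $p,q\in\mathbb{R}$, the weighted Gini mean $\mathscr{G}_{p,q}$ on $\mathbb{R}_+$ is $$\mathscr{G}_{p,q}(x,\lambda)=\begin{cases}\left(\dfrac{\sum_i\lambda_ix_i^p}{\sum_i\lambda_ix_i^q}\right)^{1/(p-q)}&\text{if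 }p\ne q,\\[3mm]\exp\left(\dfrac{\sum_i\lambda_ix_i^p\ln x_i}{\sum_i\lambda_ix_i^p}\right)&\text{if }p=q.\end{cases}$$ **Proposition.** Let $p,q\in\mathbb{R}$ with $\min(p,q)\le0\le\max(p,q)\le1$, and let $J\subseteq\mathbb{R}$ be an interval that has more than one point and is bounded below (for example $J=\mathbb{R}_+$). Then, for all $n\ge 1$ and all $\lambda\in W^{\mathbb{R}}_n(J)$, the weighted Gini mean $\mathscr{G}_{p,q}$ on $\mathbb{R}_+$ satisfies the $(n,\lambda)$-weighted Kedlaya inequality. -/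

import Mathlib

namespace WeightedMean

/-- Weight vectors of length `n`: nonnegative entries with positive sum (so `W 0` is empty). -/
def W (n : ℕ) : Set (Fin n → ℝ) :=
  {w | (∀ i, 0 ≤ w i) ∧ 0 < ∑ i, w i}

/-- Weight vectors of length `n ≥ 1` whose first entry is positive (so `W₀ 0` is empty). -/
def W₀ (n : ℕ) : Set (Fin n → ℝ) :=
  {w | (∀ i, 0 ≤ w i) ∧ ∃ h : 0 < n, 0 < w ⟨0, h⟩}

/-- The shuffle `(p₁, q₁, p₂, q₂, …, pₙ, qₙ)` of two vectors. -/
def shuffle {n : ℕ} (p q : Fin n → ℝ) : Fin (2 * n) → ℝ := fun i =>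
  if (i : ℕ) % 2 = 0 then p ⟨(i : ℕ) / 2, by omega⟩ else q ⟨(i : ℕ) / 2, by omega⟩

/-- The initial segment `(x₁, …, x_{k+1})`, where `k` is counted from zero. -/
def initial {n : ℕ} (x : Fin n → ℝ) (k : Fin n) : Fin ((k : ℕ) + 1) → ℝ := fun i =>
  x ⟨i, by omega⟩

/-- `M` is an `ℝ`-weighted mean on `I`. Here `M n x w` is the mean of the entries
`x₁, …, xₙ ∈ I` with the weights `w ∈ W n`; the values of `M` at other arguments are irrelevant. -/
structure IsWeightedMean (I : Set ℝ) (M : (n : ℕ) → (Fin n → ℝ) → (Fin n → ℝ) → ℝ) : Prop where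
  mem : ∀ (n : ℕ) (x w : Fin n → ℝ), (∀ i, x i ∈ I) → w ∈ W n → M n x w ∈ I
  nullhomogeneous : ∀ (n : ℕ) (x w : Fin n → ℝ) (t : ℝ), (∀ i, x i ∈ I) → w ∈ W n → 0 < t →
    M n x w = M n x (t • w)
  reduction : ∀ (n : ℕ) (x w v : Fin n → ℝ), (∀ i, x i ∈ I) → w ∈ W n → v ∈ W n →
    M n x (w + v) = M (2 * n) (shuffle x x) (shuffle w v)
  mean_value : ∀ (n : ℕ) (x w : Fin n → ℝ), (∀ i, x i ∈ I) → w ∈ W n →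
    (⨅ i, x i) ≤ M n x w ∧ M n x w ≤ ⨆ i, x i
  elimination : ∀ (n : ℕ) (x w : Fin (n + 1) → ℝ) (j : Fin (n + 1)), (∀ i, x i ∈ I) →
    w ∈ W (n + 1) → w j = 0 →
    M (n + 1) x w = M n (fun i => x (j.succAbove i)) (fun i => w (j.succAbove i))

/-- Invariance under simultaneous permutations of entries and weights. -/
def IsSymmetric (I : Set ℝ) (M : (n : ℕ) → (Fin n → ℝ) → (Fin n → ℝ) → ℝ) : Prop :=
  ∀ (n : ℕ) (x w : Fin n → ℝ) (σ : Equiv.Perm (Fin n)), (∀ i, x i ∈ I) → w ∈ W n →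
    M n x w = M n (x ∘ σ) (w ∘ σ)

/-- Midpoint concavity in the entries, for each fixed weight vector. -/
def IsJensenConcave (I : Set ℝ) (M : (n : ℕ) → (Fin n → ℝ) → (Fin n → ℝ) → ℝ) : Prop :=
  ∀ (n : ℕ) (x y w : Fin n → ℝ), (∀ i, x i ∈ I) → (∀ i, y i ∈ I) → w ∈ W n →
    (M n x w + M n y w) / 2 ≤ M n (fun i => (x i + y i) / 2) w

/-- Continuity in the weights, for each fixed vector of entries. -/
def IsContinuousInWeights (I : Set ℝ)
    (M : (n : ℕ) → (Fin n → ℝ) → (Fin n → ℝ) → ℝ) : Prop :=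
  ∀ (n : ℕ) (x : Fin n → ℝ), (∀ i, x i ∈ I) → ContinuousOn (fun w => M n x w) (W n)

/-- The weighted arithmetic mean. -/
noncomputable def arith (n : ℕ) (x w : Fin n → ℝ) : ℝ :=
  (∑ i, w i * x i) / ∑ i, w i

/-- The `(n, w)`-weighted Kedlaya inequality for `M` on `I`: the arithmetic mean of the partial
`M`-means is at most the `M`-mean of the partial arithmetic means. -/
def Kedlaya (I : Set ℝ) (M : (n : ℕ) → (Fin n → ℝ) → (Fin n → ℝ) → ℝ)
    (n : ℕ) (w : Fin n → ℝ) : Prop :=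
  ∀ x : Fin n → ℝ, (∀ i, x i ∈ I) →
    arith n (fun k => M ((k : ℕ) + 1) (initial x k) (initial w k)) w ≤
      M n (fun k => arith ((k : ℕ) + 1) (initial x k) (initial w k)) w

/-- The weights `w ∈ W₀ n` such that every symmetric and Jensen concave `ℝ`-weighted mean on `I`
that is continuous in the weights satisfies the `(n, w)`-weighted Kedlaya inequality. -/
def WR (I : Set ℝ) (n : ℕ) : Set (Fin n → ℝ) :=
  {w | w ∈ W₀ n ∧ ∀ M : (n : ℕ) → (Fin n → ℝ) → (Fin n → ℝ) → ℝ,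
    IsWeightedMean I M → IsSymmetric I M → IsJensenConcave I M → IsContinuousInWeights I M →
    Kedlaya I M n w}

/-- The weighted Gini mean of parameters `p`, `q` on the positive reals. -/
noncomputable def gini (p q : ℝ) (n : ℕ) (x w : Fin n → ℝ) : ℝ :=
  if p = q then
    Real.exp ((∑ i, w i * (x i ^ p * Real.log (x i))) / ∑ i, w i * x i ^ p)
  else
    ((∑ i, w i * x i ^ p) / ∑ i, w i * x i ^ q) ^ (1 / (p - q))

end WeightedMean

namespace WeightedMean

open Set

/-! The difficulty is that the weights are tested on `J`, while the Gini mean lives on the positive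
reals. Fix positive entries `x`. Since `J` is bounded below, some map `z ↦ t * z + s` with `t > 0`
and `s` strictly below `J` carries all of them into `J` (`exists_affine_mem`). Conjugating the Gini
mean by translation by `s` gives a mean on `J` to which the hypothesis applies. Arithmetic means
commute with affine maps and Gini means are homogeneous (`arith_affine`, `gini_mul`), so its Kedlaya
inequality at `t * x + s` is the desired one after removing `s` and `t`.

The substantial property of the Gini mean is Jensen concavity (`gini_superadditive`), which comes
from concavity of the deviation function `giniDev`. -/

lemma mem_W_of_mem_W₀ {n : ℕ} {w : Fin n → ℝ} (hw : w ∈ W₀ n) : w ∈ W n := by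
  obtain ⟨h0, h, hpos⟩ := hw
  exact ⟨h0, Finset.sum_pos' (fun i _ => h0 i) ⟨_, Finset.mem_univ _, hpos⟩⟩

lemma initial_mem_W {n : ℕ} {w : Fin n → ℝ} (hw : w ∈ W₀ n) (k : Fin n) :
    initial w k ∈ W ((k : ℕ) + 1) := by
  obtain ⟨h0, h, hpos⟩ := hw
  refine ⟨fun i => h0 _, Finset.sum_pos' (fun i _ => h0 _) ⟨0, Finset.mem_univ _, ?_⟩⟩
  exact hpos

lemma sum_mul_pos {n : ℕ} {w y : Fin n → ℝ} (hw : w ∈ W n) (hy : ∀ i, 0 < y i) :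
    0 < ∑ i, w i * y i := by
  obtain ⟨h0, hpos⟩ := hw
  obtain ⟨i, -, hi⟩ := Finset.exists_lt_of_sum_lt (s := Finset.univ) (f := fun _ : Fin n => (0 : ℝ))
    (g := w) (by simpa using hpos)
  exact Finset.sum_pos' (fun i _ => mul_nonneg (h0 i) (hy i).le)
    ⟨i, Finset.mem_univ _, mul_pos hi (hy i)⟩

lemma nonempty_of_mem_W {n : ℕ} {w : Fin n → ℝ} (hw : w ∈ W n) : Nonempty (Fin n) := by
  by_contra h
  rw [not_nonempty_iff] at h
  have := hw.2
  simp at this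

lemma arith_pos {n : ℕ} {w x : Fin n → ℝ} (hw : w ∈ W n) (hx : ∀ i, 0 < x i) :
    0 < arith n x w :=
  div_pos (sum_mul_pos hw hx) hw.2

lemma arith_affine {n : ℕ} {w : Fin n → ℝ} (hw : w ∈ W n) (x : Fin n → ℝ) (t s : ℝ) :
    arith n (fun i => t * x i + s) w = t * arith n x w + s := by
  have h : ∑ i, w i * (t * x i + s) = t * ∑ i, w i * x i + s * ∑ i, w i := by
    rw [Finset.mul_sum, Finset.mul_sum, ← Finset.sum_add_distrib]
    exact Finset.sum_congr rfl fun i _ => by ring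
  have := hw.2.ne'
  rw [arith, arith, h]
  field_simp

lemma sum_shuffle {n : ℕ} (x w v : Fin n → ℝ) (g : ℝ → ℝ) :
    ∑ i, shuffle w v i * g (shuffle x x i) = ∑ i, (w + v) i * g (x i) := by
  have e : ∑ i, shuffle w v i * g (shuffle x x i) =
      ∑ i : Fin n × Fin 2, shuffle w v (finProdFinEquiv.trans (finCongr (mul_comm n 2)) i) *
        g (shuffle x x (finProdFinEquiv.trans (finCongr (mul_comm n 2)) i)) :=
    (Equiv.sum_comp (finProdFinEquiv.trans (finCongr (mul_comm n 2)))
      -- The pair `(a, b)` corresponds to the index `b + 2 * a`, so `b` is the parity selecting `w`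
      -- or `v`.
      (fun i => shuffle w v i * g (shuffle x x i))).symm
  rw [e, Fintype.sum_prod_type]
  refine Finset.sum_congr rfl fun i _ => ?_
  have h1 : (1 + 2 * (i : ℕ)) / 2 = i := by omega
  rw [Fin.sum_univ_two]
  simp [shuffle, finProdFinEquiv, h1, add_mul]

/-! ### Gini means as deviation means -/

/-- The function `t ↦ f t` for which the Gini mean `m` of `x` solves `∑ i, w i * f (x i / m) = 0`. -/
noncomputable def giniDev (p q t : ℝ) : ℝ :=
  if p = q then t ^ p * Real.log t else (t ^ p - t ^ q) / (p - q)

lemma gini_pos {p q : ℝ} {n : ℕ} {x w : Fin n → ℝ} (hw : w ∈ W n) (hx : ∀ i, 0 < x i) :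
    0 < gini p q n x w := by
  unfold gini
  split_ifs
  · exact Real.exp_pos _
  · exact Real.rpow_pos_of_pos (div_pos
      (sum_mul_pos (y := fun i => x i ^ p) hw fun i => Real.rpow_pos_of_pos (hx i) p)
      (sum_mul_pos (y := fun i => x i ^ q) hw fun i => Real.rpow_pos_of_pos (hx i) q)) _

lemma sum_rpow_mul {n : ℕ} {x : Fin n → ℝ} (w : Fin n → ℝ) (hx : ∀ i, 0 < x i) {t : ℝ}
    (ht : 0 < t) (r : ℝ) : ∑ i, w i * (t * x i) ^ r = t ^ r * ∑ i, w i * x i ^ r := by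
  rw [Finset.mul_sum]
  refine Finset.sum_congr rfl fun i _ => ?_
  rw [Real.mul_rpow ht.le (hx i).le]
  ring

lemma gini_mul {p q : ℝ} {n : ℕ} {x w : Fin n → ℝ} (hw : w ∈ W n) (hx : ∀ i, 0 < x i) {t : ℝ}
    (ht : 0 < t) : gini p q n (fun i => t * x i) w = t * gini p q n x w := by
  have hS : ∀ r : ℝ, 0 < ∑ i, w i * x i ^ r := fun r =>
    sum_mul_pos (y := fun i => x i ^ r) hw fun i => Real.rpow_pos_of_pos (hx i) r
  have hp := hS p
  have hq := hS q
  have htp := Real.rpow_pos_of_pos ht p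
  have htq := Real.rpow_pos_of_pos ht q
  unfold gini
  split_ifs with h
  · have e : ∑ i, w i * ((t * x i) ^ p * Real.log (t * x i)) =
        t ^ p * (Real.log t * ∑ i, w i * x i ^ p + ∑ i, w i * (x i ^ p * Real.log (x i))) := by
      rw [mul_add, Finset.mul_sum, Finset.mul_sum, Finset.mul_sum, ← Finset.sum_add_distrib]
      refine Finset.sum_congr rfl fun i _ => ?_
      rw [Real.mul_rpow ht.le (hx i).le, Real.log_mul ht.ne' (hx i).ne']
      ring
    rw [e, sum_rpow_mul w hx ht, mul_div_mul_left _ _ htp.ne', add_div,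
      mul_div_cancel_right₀ _ hp.ne', Real.exp_add, Real.exp_log ht]
  · rw [sum_rpow_mul w hx ht, sum_rpow_mul w hx ht, mul_div_mul_comm, ← Real.rpow_sub ht,
      Real.mul_rpow (Real.rpow_pos_of_pos ht _).le (div_pos hp hq).le, ← Real.rpow_mul ht.le,
      mul_one_div_cancel (sub_ne_zero.2 h), Real.rpow_one]

lemma sum_giniDev {p q : ℝ} (h : p ≠ q) {n : ℕ} (x w : Fin n → ℝ) :
    ∑ i, w i * giniDev p q (x i) =
      ((∑ i, w i * x i ^ p) - ∑ i, w i * x i ^ q) / (p - q) := by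
  rw [← Finset.sum_sub_distrib, Finset.sum_div]
  refine Finset.sum_congr rfl fun i _ => ?_
  rw [giniDev, if_neg h]
  ring

/-- When `p < q` the outer power reverses order, but so does the division by `p - q` in `giniDev`;
the two reversals cancel. -/
lemma one_le_gini_iff {p q : ℝ} {n : ℕ} {x w : Fin n → ℝ} (hw : w ∈ W n) (hx : ∀ i, 0 < x i) :
    1 ≤ gini p q n x w ↔ 0 ≤ ∑ i, w i * giniDev p q (x i) := by
  have hS : ∀ r : ℝ, 0 < ∑ i, w i * x i ^ r := fun r =>
    sum_mul_pos (y := fun i => x i ^ r) hw fun i => Real.rpow_pos_of_pos (hx i) r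
  by_cases h : p = q
  · simp only [gini, giniDev, if_pos h, Real.one_le_exp_iff]
    exact ⟨fun h' => by simpa using (le_div_iff₀ (hS p)).1 h', fun h' => div_nonneg h' (hS p).le⟩
  · rw [sum_giniDev h, gini, if_neg h]
    generalize hA : ∑ i, w i * x i ^ p = A
    generalize hB : ∑ i, w i * x i ^ q = B
    have hA0 : 0 < A := hA ▸ hS p
    have hB0 : 0 < B := hB ▸ hS q
    rcases lt_or_gt_of_ne h with h | h
    · rw [one_div, Real.le_rpow_inv_iff_of_neg one_pos (div_pos hA0 hB0) (sub_neg.2 h),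
        Real.one_rpow, div_le_one hB0]
      rw [← neg_div_neg_eq, le_div_iff₀ (by linarith)]
      constructor <;> intro <;> linarith
    · rw [one_div, Real.le_rpow_inv_iff_of_pos zero_le_one (div_pos hA0 hB0).le (sub_pos.2 h),
        Real.one_rpow, one_le_div hB0, le_div_iff₀ (by linarith)]
      constructor <;> intro <;> linarith

lemma gini_le_one_iff {p q : ℝ} {n : ℕ} {x w : Fin n → ℝ} (hw : w ∈ W n) (hx : ∀ i, 0 < x i) :
    gini p q n x w ≤ 1 ↔ ∑ i, w i * giniDev p q (x i) ≤ 0 := by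
  have hS : ∀ r : ℝ, 0 < ∑ i, w i * x i ^ r := fun r =>
    sum_mul_pos (y := fun i => x i ^ r) hw fun i => Real.rpow_pos_of_pos (hx i) r
  by_cases h : p = q
  · simp only [gini, giniDev, if_pos h, Real.exp_le_one_iff]
    exact ⟨fun h' => by simpa using (div_le_iff₀ (hS p)).1 h',
      fun h' => div_nonpos_of_nonpos_of_nonneg h' (hS p).le⟩
  · rw [sum_giniDev h, gini, if_neg h]
    generalize hA : ∑ i, w i * x i ^ p = A
    generalize hB : ∑ i, w i * x i ^ q = B
    have hA0 : 0 < A := hA ▸ hS p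
    have hB0 : 0 < B := hB ▸ hS q
    rcases lt_or_gt_of_ne h with h | h
    · rw [one_div, Real.rpow_inv_le_iff_of_neg (div_pos hA0 hB0) one_pos (sub_neg.2 h),
        Real.one_rpow, one_le_div hB0]
      rw [← neg_div_neg_eq, div_le_iff₀ (by linarith)]
      constructor <;> intro <;> linarith
    · rw [one_div, Real.rpow_inv_le_iff_of_pos (div_pos hA0 hB0).le zero_le_one (sub_pos.2 h),
        Real.one_rpow, div_le_one hB0, div_le_iff₀ (by linarith)]
      constructor <;> intro <;> linarith

lemma gini_div {p q : ℝ} {n : ℕ} {x w : Fin n → ℝ} (hw : w ∈ W n) (hx : ∀ i, 0 < x i) {c : ℝ}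
    (hc : 0 < c) : gini p q n (fun i => x i / c) w = gini p q n x w / c := by
  simpa only [div_eq_inv_mul] using gini_mul hw hx (inv_pos.2 hc)

lemma le_gini_iff {p q : ℝ} {n : ℕ} {x w : Fin n → ℝ} (hw : w ∈ W n) (hx : ∀ i, 0 < x i) {c : ℝ}
    (hc : 0 < c) : c ≤ gini p q n x w ↔ 0 ≤ ∑ i, w i * giniDev p q (x i / c) := by
  rw [← one_le_gini_iff hw fun i => div_pos (hx i) hc, gini_div hw hx hc, one_le_div hc]

lemma gini_le_iff {p q : ℝ} {n : ℕ} {x w : Fin n → ℝ} (hw : w ∈ W n) (hx : ∀ i, 0 < x i) {c : ℝ}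
    (hc : 0 < c) : gini p q n x w ≤ c ↔ ∑ i, w i * giniDev p q (x i / c) ≤ 0 := by
  rw [← gini_le_one_iff hw fun i => div_pos (hx i) hc, gini_div hw hx hc, div_le_one hc]

/-- With `giniDev_nonpos`, this sign change at 1 yields the mean value property. -/
lemma giniDev_nonneg (p q : ℝ) {t : ℝ} (ht : 1 ≤ t) : 0 ≤ giniDev p q t := by
  unfold giniDev
  split_ifs with h
  · exact mul_nonneg (Real.rpow_nonneg (by linarith) p) (Real.log_nonneg ht)
  · rcases lt_or_gt_of_ne h with h | h
    · exact div_nonneg_of_nonpos (sub_nonpos.2 (Real.rpow_le_rpow_of_exponent_le ht h.le))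
        (by linarith)
    · exact div_nonneg (sub_nonneg.2 (Real.rpow_le_rpow_of_exponent_le ht h.le)) (by linarith)

lemma giniDev_nonpos (p q : ℝ) {t : ℝ} (h0 : 0 < t) (ht : t ≤ 1) : giniDev p q t ≤ 0 := by
  unfold giniDev
  split_ifs with h
  · exact mul_nonpos_of_nonneg_of_nonpos (Real.rpow_nonneg h0.le p) (Real.log_nonpos h0.le ht)
  · rcases lt_or_gt_of_ne h with h | h
    · exact div_nonpos_of_nonneg_of_nonpos
        (sub_nonneg.2 (Real.rpow_le_rpow_of_exponent_ge h0 ht h.le)) (by linarith)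
    · exact div_nonpos_of_nonpos_of_nonneg
        (sub_nonpos.2 (Real.rpow_le_rpow_of_exponent_ge h0 ht h.le)) (by linarith)

/-! ### Concavity -/

lemma convexOn_rpow_of_nonpos {r : ℝ} (hr : r ≤ 0) : ConvexOn ℝ (Ioi 0) fun t : ℝ => t ^ r := by
  refine ⟨convex_Ioi 0, fun x hx y hy a b ha hb hab => ?_⟩
  have hx' : (0 : ℝ) < x := hx
  have hy' : (0 : ℝ) < y := hy
  have hz : 0 < a • x + b • y := convex_Ioi 0 hx hy ha hb hab
  have hlog := strictConcaveOn_log_Ioi.concaveOn.2 hx hy ha hb hab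
  have hexp := convexOn_exp.2 (mem_univ (Real.log x * r)) (mem_univ (Real.log y * r)) ha hb hab
  simp only [Real.rpow_def_of_pos hx', Real.rpow_def_of_pos hy', Real.rpow_def_of_pos hz]
  refine (Real.exp_le_exp.2 ?_).trans hexp
  simp only [smul_eq_mul] at hlog ⊢
  linarith [mul_le_mul_of_nonpos_right hlog hr]

/-- The larger exponent gives a concave power, the smaller a convex one, and `giniDev` is symmetric
in `p`, `q`. Equality forces `p = q = 0`, leaving the logarithm. -/
lemma concaveOn_giniDev {p q : ℝ} (hmin : min p q ≤ 0) (hmax : 0 ≤ max p q)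
    (hmax' : max p q ≤ 1) : ConcaveOn ℝ (Ioi 0) (giniDev p q) := by
  have key : ∀ {a b : ℝ}, b < a → b ≤ 0 → 0 ≤ a → a ≤ 1 →
      ConcaveOn ℝ (Ioi 0) fun t : ℝ => (t ^ a - t ^ b) / (a - b) := by
    intro a b hab hb ha ha'
    have h1 : ConcaveOn ℝ (Ioi 0) fun t : ℝ => t ^ a :=
      (Real.concaveOn_rpow ha ha').subset Ioi_subset_Ici_self (convex_Ioi 0)
    have := (h1.sub (convexOn_rpow_of_nonpos hb)).smul (inv_nonneg.2 (sub_pos.2 hab).le)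
    simpa only [div_eq_inv_mul, smul_eq_mul, Pi.sub_apply] using this
  rcases lt_trichotomy p q with h | h | h
  · rw [min_eq_left h.le] at hmin
    rw [max_eq_right h.le] at hmax hmax'
    refine (key h hmin hmax hmax').congr fun t _ => ?_
    rw [giniDev, if_neg h.ne, ← neg_div_neg_eq, neg_sub, neg_sub]
  · subst h
    rw [min_self] at hmin
    rw [max_self] at hmax
    obtain rfl : p = 0 := le_antisymm hmin hmax
    refine strictConcaveOn_log_Ioi.concaveOn.congr fun t _ => ?_
    simp [giniDev]
  · rw [min_eq_right h.le] at hmin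
    rw [max_eq_left h.le] at hmax hmax'
    refine (key h hmin hmax hmax').congr fun t _ => ?_
    rw [giniDev, if_neg h.ne']

/-- If `a`, `b` are the two means, `(x + y) / (a + b)` is the convex combination of `x / a` and `y /
b` with weights `a / (a + b)` and `b / (a + b)`. -/
lemma gini_superadditive {p q : ℝ} (hf : ConcaveOn ℝ (Ioi 0) (giniDev p q)) {n : ℕ}
    {x y w : Fin n → ℝ} (hw : w ∈ W n) (hx : ∀ i, 0 < x i) (hy : ∀ i, 0 < y i) :
    gini p q n x w + gini p q n y w ≤ gini p q n (fun i => x i + y i) w := by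
  have ha := gini_pos (p := p) (q := q) hw hx
  have hb := gini_pos (p := p) (q := q) hw hy
  have hxa := (le_gini_iff (p := p) (q := q) hw hx ha).1 le_rfl
  have hyb := (le_gini_iff (p := p) (q := q) hw hy hb).1 le_rfl
  generalize gini p q n x w = a at *
  generalize gini p q n y w = b at *
  have hab : 0 < a + b := add_pos ha hb
  rw [le_gini_iff hw (fun i => add_pos (hx i) (hy i)) hab]
  calc (0 : ℝ) ≤ a / (a + b) * ∑ i, w i * giniDev p q (x i / a) +
        b / (a + b) * ∑ i, w i * giniDev p q (y i / b) := by positivity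
    _ = ∑ i, w i * (a / (a + b) * giniDev p q (x i / a) + b / (a + b) * giniDev p q (y i / b)) := by
      rw [Finset.mul_sum, Finset.mul_sum, ← Finset.sum_add_distrib]
      exact Finset.sum_congr rfl fun i _ => by ring
    _ ≤ _ := by
      refine Finset.sum_le_sum fun i _ => mul_le_mul_of_nonneg_left ?_ (hw.1 i)
      have := hf.2 (mem_Ioi.2 (div_pos (hx i) ha)) (mem_Ioi.2 (div_pos (hy i) hb))
        (div_pos ha hab).le (div_pos hb hab).le (by field_simp)
      simp only [smul_eq_mul] at this
      refine this.trans_eq (congrArg _ ?_)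
      field_simp

/-! ### Axioms of a mean for `gini` -/

lemma isJensenConcave_gini {p q : ℝ} (hf : ConcaveOn ℝ (Ioi 0) (giniDev p q)) :
    IsJensenConcave (Ioi 0) (gini p q) := by
  intro n x y w hx hy hw
  have h := gini_superadditive hf hw hx hy
  have e := gini_mul (p := p) (q := q) hw (fun i => add_pos (hx i) (hy i)) (t := 1 / 2) (by norm_num)
  have e' : (fun i => (x i + y i) / 2) = fun i => 1 / 2 * (x i + y i) := by
    funext i; ring
  rw [e', e]
  linarith

lemma isSymmetric_gini (p q : ℝ) : IsSymmetric (Ioi 0) (gini p q) := by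
  intro n x w σ _ _
  have h : ∀ g : ℝ → ℝ, ∑ i, (w ∘ σ) i * g ((x ∘ σ) i) = ∑ i, w i * g (x i) := fun g =>
    Equiv.sum_comp σ fun i => w i * g (x i)
  simp only [gini, h fun t => t ^ p, h fun t => t ^ q, h fun t => t ^ p * Real.log t]

lemma isContinuousInWeights_gini (p q : ℝ) : IsContinuousInWeights (Ioi 0) (gini p q) := by
  intro n x hx
  have hS : ∀ (r : ℝ), ∀ w ∈ W n, 0 < ∑ i, w i * x i ^ r := fun r w hw =>
    sum_mul_pos (y := fun i => x i ^ r) hw fun i => Real.rpow_pos_of_pos (hx i) r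
  have hc : ∀ y : Fin n → ℝ, ContinuousOn (fun w : Fin n → ℝ => ∑ i, w i * y i) (W n) :=
    fun y => Continuous.continuousOn (by fun_prop)
  by_cases h : p = q
  · simp only [gini, if_pos h]
    exact ((hc _).div (hc _) fun w hw => (hS p w hw).ne').rexp
  · simp only [gini, if_neg h]
    exact ((hc _).div (hc _) fun w hw => (hS q w hw).ne').rpow_const
      fun w hw => Or.inl (div_pos (hS p w hw) (hS q w hw)).ne'

lemma isWeightedMean_gini (p q : ℝ) : IsWeightedMean (Ioi 0) (gini p q) where
  mem _ _ _ hx hw := gini_pos hw hx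
  nullhomogeneous n x w t _ _ ht := by
    have h : ∀ y : Fin n → ℝ, ∑ i, (t • w) i * y i = t * ∑ i, w i * y i := fun y => by
      simp [Finset.mul_sum, mul_assoc]
    simp only [gini, h, mul_div_mul_left _ _ ht.ne']
  reduction n x w v _ _ _ := by
    simp only [gini, sum_shuffle x w v fun t => t ^ p, sum_shuffle x w v fun t => t ^ q,
      sum_shuffle x w v fun t => t ^ p * Real.log t]
  mean_value n x w hx hw := by
    have := nonempty_of_mem_W hw
    have hfin := Set.finite_range x
    obtain ⟨j, hj⟩ := exists_eq_ciInf_of_finite (f := x)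
    obtain ⟨k, hk⟩ := exists_eq_ciSup_of_finite (f := x)
    have hj' : ∀ i, x j ≤ x i := fun i => hj ▸ ciInf_le hfin.bddBelow i
    have hk' : ∀ i, x i ≤ x k := fun i => hk ▸ le_ciSup hfin.bddAbove i
    rw [← hj, ← hk, le_gini_iff hw hx (hx j), gini_le_iff hw hx (hx k)]
    exact ⟨Finset.sum_nonneg fun i _ => mul_nonneg (hw.1 i)
        (giniDev_nonneg p q ((one_le_div (hx j)).2 (hj' i))),
      Finset.sum_nonpos fun i _ => mul_nonpos_of_nonneg_of_nonpos (hw.1 i)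
        (giniDev_nonpos p q (div_pos (hx i) (hx k)) ((div_le_one (hx k)).2 (hk' i)))⟩
  elimination n x w j _ _ hj := by
    simp only [gini, Fin.sum_univ_succAbove _ j, hj, zero_mul, zero_add]

/-! ### Transport to `J` -/

/-- The mean on a translate of the domain obtained by conjugating with the translation by `s`. -/
def translate (s : ℝ) (M : (n : ℕ) → (Fin n → ℝ) → (Fin n → ℝ) → ℝ) :
    (n : ℕ) → (Fin n → ℝ) → (Fin n → ℝ) → ℝ :=
  fun n x w => M n (fun i => x i - s) w + s

section translate

variable {I J : Set ℝ} {M : (n : ℕ) → (Fin n → ℝ) → (Fin n → ℝ) → ℝ} {s : ℝ}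

lemma IsWeightedMean.translate (hM : IsWeightedMean I M) (hJ : J.OrdConnected)
    (h : ∀ x ∈ J, x - s ∈ I) : IsWeightedMean J (translate s M) := by
  have hmv : ∀ (n : ℕ) (x w : Fin n → ℝ), (∀ i, x i ∈ J) → w ∈ W n →
      (⨅ i, x i) ≤ WeightedMean.translate s M n x w ∧
        WeightedMean.translate s M n x w ≤ ⨆ i, x i := by
    intro n x w hx hw
    have := nonempty_of_mem_W hw
    obtain ⟨h1, h2⟩ := hM.mean_value n (fun i => x i - s) w (fun i => h _ (hx i)) hw
    rw [← ciInf_sub (Set.finite_range x).bddBelow] at h1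
    rw [← ciSup_sub (Set.finite_range x).bddAbove] at h2
    exact ⟨sub_le_iff_le_add.1 h1, le_sub_iff_add_le.1 h2⟩
  refine ⟨fun n x w hx hw => ?_, fun n x w t hx hw ht => ?_, fun n x w v hx hw hv => ?_, hmv,
    fun n x w j hx hw hj => ?_⟩
  -- `hM.mem` only places the value in `I + s`, which may exceed `J`; lying between two entries
  -- suffices.
  · have := nonempty_of_mem_W hw
    obtain ⟨j, hj⟩ := exists_eq_ciInf_of_finite (f := x)
    obtain ⟨k, hk⟩ := exists_eq_ciSup_of_finite (f := x)
    have := hmv n x w hx hw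
    rw [← hj, ← hk] at this
    exact hJ.out (hx j) (hx k) this
  · exact congrArg (· + s) (hM.nullhomogeneous n _ w t (fun i => h _ (hx i)) hw ht)
  · exact congrArg (· + s) <| hM.reduction n _ w v (fun i => h _ (hx i)) hw hv |>.trans <|
      congrArg (M (2 * n) · _) <| by
        funext i; unfold shuffle; split_ifs <;> rfl
  · exact congrArg (· + s) (hM.elimination n _ w j (fun i => h _ (hx i)) hw hj)

lemma IsSymmetric.translate (hM : IsSymmetric I M) (h : ∀ x ∈ J, x - s ∈ I) :
    IsSymmetric J (translate s M) := fun n _ w σ hx hw =>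
  congrArg (· + s) (hM n _ w σ (fun i => h _ (hx i)) hw)

lemma IsJensenConcave.translate (hM : IsJensenConcave I M) (h : ∀ x ∈ J, x - s ∈ I) :
    IsJensenConcave J (translate s M) := by
  intro n x y w hx hy hw
  have := hM n _ _ w (fun i => h _ (hx i)) (fun i => h _ (hy i)) hw
  have e : (fun i => (x i - s + (y i - s)) / 2) = fun i => (x i + y i) / 2 - s := by
    funext i; ring
  rw [e] at this
  unfold WeightedMean.translate
  linarith

lemma IsContinuousInWeights.translate (hM : IsContinuousInWeights I M) (h : ∀ x ∈ J, x - s ∈ I) :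
    IsContinuousInWeights J (translate s M) := fun n _ hx =>
  (hM n _ fun i => h _ (hx i)).add continuousOn_const

end translate

/-- Any finite family of positive numbers can be mapped into an interval bounded below by an
increasing affine map whose constant term lies strictly below the interval. -/
lemma exists_affine_mem {J : Set ℝ} (hJ : J.OrdConnected) (hJ' : J.Nontrivial) (hJb : BddBelow J)
    {ι : Type*} [Finite ι] [Nonempty ι] (x : ι → ℝ) (hx : ∀ i, 0 < x i) :
    ∃ t s : ℝ, 0 < t ∧ (∀ z ∈ J, s < z) ∧ ∀ i, t * x i + s ∈ J := by
  obtain ⟨j, hj⟩ := Finite.exists_min x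
  obtain ⟨k, hk⟩ := Finite.exists_max x
  obtain ⟨u₀, hu₀, v, hv, huv⟩ := hJ'.exists_lt
  set a := sInf J
  have hav : a < v := (csInf_le hJb hu₀).trans_lt huv
  have hxj := hx j
  have hxk := hx k
  -- Put `s = a - δ` and send the least entry to `u < a + δ`. As `u - s < 2 * δ`, the largest entry
  -- then lands below `s + (v - a) = v - δ`.
  set δ := (v - a) * x j / (2 * x k) with hδ
  have hδ0 : 0 < δ := div_pos (mul_pos (sub_pos.2 hav) hxj) (by linarith)
  obtain ⟨u, hu, hua⟩ := exists_lt_of_csInf_lt ⟨v, hv⟩ (lt_add_of_pos_right a hδ0)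
  have hau : a ≤ u := csInf_le hJb hu
  have ht : 0 < (u - (a - δ)) / x j := div_pos (by linarith) hxj
  refine ⟨(u - (a - δ)) / x j, a - δ, ht, fun z hz => ?_, fun i => hJ.out hu hv ⟨?_, ?_⟩⟩
  · have := csInf_le hJb hz
    linarith
  · have := mul_le_mul_of_nonneg_left (hj i) ht.le
    rw [div_mul_cancel₀ _ hxj.ne'] at this
    linarith
  · have h1 := mul_le_mul_of_nonneg_left (hk i) ht.le
    have h2 : (u - (a - δ)) / x j * x k ≤ 2 * δ / x j * x k := by
      gcongr
      linarith
    have h3 : 2 * δ / x j * x k = v - a := by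
      rw [hδ]
      field_simp
    linarith

end WeightedMean

open WeightedMean in
theorem proposition4p7 (p q : ℝ) (hmin : min p q ≤ 0) (hmax : 0 ≤ max p q) (hmax' : max p q ≤ 1)
    (J : Set ℝ) (hJ : J.OrdConnected) (hJ' : J.Nontrivial) (hJb : BddBelow J)
    (n : ℕ) (w : Fin n → ℝ) (hw : w ∈ WeightedMean.WR J n) :
    WeightedMean.Kedlaya (Set.Ioi 0) (WeightedMean.gini p q) n w := by
  intro x hx
  obtain ⟨hw₀, hK⟩ := hw
  have hwn := mem_W_of_mem_W₀ hw₀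
  have hwk := initial_mem_W hw₀
  have := nonempty_of_mem_W hwn
  have hf := concaveOn_giniDev hmin hmax hmax'
  obtain ⟨t, s, ht, hs, hmem⟩ := exists_affine_mem hJ hJ' hJb x hx
  have hsJ : ∀ z ∈ J, z - s ∈ Set.Ioi (0 : ℝ) := fun z hz => sub_pos.2 (hs z hz)
  have key := hK _ ((isWeightedMean_gini p q).translate hJ hsJ)
    ((isSymmetric_gini p q).translate hsJ) ((isJensenConcave_gini hf).translate hsJ)
    ((isContinuousInWeights_gini p q).translate hsJ) (fun i => t * x i + s) hmem
  have hA : ∀ k : Fin n, 0 < arith ((k : ℕ) + 1) (initial x k) (initial w k) := fun k =>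
    arith_pos (hwk k) fun i => hx _
  have e1 : (fun k : Fin n => WeightedMean.translate s (gini p q) ((k : ℕ) + 1)
      (initial (fun i => t * x i + s) k) (initial w k)) =
      fun k : Fin n => t * gini p q ((k : ℕ) + 1) (initial x k) (initial w k) + s := by
    funext k
    rw [WeightedMean.translate, ← gini_mul (x := initial x k) (hwk k) (fun i => hx _) ht]
    simp only [initial, add_sub_cancel_right]
  have e2 : (fun k : Fin n => arith ((k : ℕ) + 1) (initial (fun i => t * x i + s) k)
      (initial w k)) = fun k : Fin n => t * arith ((k : ℕ) + 1) (initial x k) (initial w k) + s :=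
    funext fun k => arith_affine (hwk k) (initial x k) t s
  rw [e1, e2, arith_affine hwn] at key
  simp only [WeightedMean.translate, add_sub_cancel_right] at key
  rw [gini_mul hwn hA ht] at key
  exact le_of_mul_le_mul_left (by linarith) ht
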